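/- Consider a network with two base stations (BSs) $1,2$, placed at the centres of two hotspots $1,2$. Users arrive according to a Poisson process of rate $\lambda>0$; each arriving user is, independently, in hotspot $k$ with probability $p_k$, where $p_1,p_2\ge 0$ and $p_1+p_2=1$. A user in hotspot $k$ can associate with BS $k$ at data rate $c_2$ or with the other BS at data rate $c_1$, where $c_2>c_1$ and $c_1=1$. File sizes are independent and exponentially distributed with parameter $\mu>0$. BS $i$ has $m_i$ RF chains, so that a user associated with BS $i$ at rate $r$, when $X_i\ge 1$ users are associated with BS $i$, has throughput $\min(m_i,X_i)\,r/X_i$; a user leaves when its file is transmitted. The state of the system is $s=(X_{ir})_{i,r\in\{1,2\}}$, where $X_{ir}$ is the number of users associated with BS $i$ at rate $c_r$. An association policy assigns to each state and each hotspot $k$ a probability distribution on $\{1,2\}$, according to which a user arriving in hotspot $k$ in that state chooses the BS it associates with (for good). A policy induces a continuous time Markov chain: from state $s$, users join BS $i$ at rate $c_r$ with intensity $\lambda\,p_{\mathrm{total}}(s,i,r)$, where $p_{\mathrm{total}}(s,i,r)$ is the probability that a user arriving in state $s$ joins BS $i$ at rate $c_r$; and, if $X_{ir}>0$, users of BS $i$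 with rate $c_r$ depart with intensity $\mu\min(m_i,X_{i1}+X_{i2})\,\frac{X_{ir}c_r}{X_{i1}+X_{i2}}$. The system is stable under the policy if this chain, on the set of states reachable from the empty state, is positive recurrent (the expected return time to each such state is finite). **Theorem.** Let $m_1=m_2=1$ and $c_1=1$. There exists an association policy under which the system is stable if and only if $$\lambda<\lambda^*,\qquad \lambda^*=\frac{\mu\,c_2(1+c_2)}{\max(p_1,p_2)\,c_2+\min(p_1,p_2)}.$$ -/

import Mathlib

open MeasureTheory ProbabilityTheory
open scoped ENNReal

/-! ### Continuous time Markov chains on a countable state space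

A continuous time Markov chain is given by its jump rates: `q s t` is the rate of jumps from `s`
to `t`. It is built from its jump chain and its exponential holding times. -/

namespace MarkovJump

section

variable {S : Type*}

/-- The total transition rate out of the state `s`. -/
noncomputable def exitRate (q : S → S → ℝ≥0∞) (s : S) : ℝ≥0∞ := ∑' t, q s t

open scoped Classical in
/-- The transition probabilities out of `s` of the embedded discrete time chain:
`q s t / exitRate q s`. (A state that is never left, or is left instantaneously, is made absorbing
for the embedded chain.) -/
noncomputable def jumpPMF (q : S → S → ℝ≥0∞) (s : S) : PMF S :=
  if h : exitRate q s ≠ 0 ∧ exitRate q s ≠ ∞ then PMF.normalize (q s) h.1 h.2 else PMF.pure s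

/-- The time of the `n`-th jump, when the visited states are `y 0, y 1, …` and the `k`-th holding
time is `e k / exitRate q (y k)`; if `e k` is exponential with parameter `1`, then the holding time
is exponential with parameter `exitRate q (y k)`. -/
noncomputable def jumpTime (q : S → S → ℝ≥0∞) (y : ℕ → S) (e : ℕ → ℝ) (n : ℕ) : ℝ≥0∞ :=
  ∑ k ∈ Finset.range n, ENNReal.ofReal (e k) / exitRate q (y k)

/-- The first time, after having left the initial state, at which the chain enters `s`
(`∞` if this never happens). -/
noncomputable def returnTime (q : S → S → ℝ≥0∞) (s : S) (y : ℕ → S) (e : ℕ → ℝ) : ℝ≥0∞ :=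
  ⨅ n : ℕ, ⨅ _ : 1 ≤ n ∧ y n = s, jumpTime q y e n

/-- `t` can be reached from `s` through transitions of positive rate. -/
def Reachable (q : S → S → ℝ≥0∞) (s t : S) : Prop :=
  Relation.ReflTransGen (fun a b => 0 < q a b) s t

variable [MeasurableSpace S] [DiscreteMeasurableSpace S]

/-- The transition kernel of the embedded discrete time chain. -/
noncomputable def jumpKernel (q : S → S → ℝ≥0∞) : Kernel S S where
  toFun s := (jumpPMF q s).toMeasure
  measurable' := Measurable.of_discrete

instance jumpKernel_isMarkovKernel (q : S → S → ℝ≥0∞) : IsMarkovKernel (jumpKernel q) :=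
  ⟨fun s => PMF.toMeasure.isProbabilityMeasure (jumpPMF q s)⟩

/-- The law of the embedded discrete time chain `y 0, y 1, …` started in `y 0 = s`. -/
noncomputable def jumpChainLaw (q : S → S → ℝ≥0∞) (s : S) : Measure (ℕ → S) :=
  Kernel.traj (X := fun _ : ℕ => S)
    (fun n => (jumpKernel q).comap
      (fun h : (i : Finset.Iic n) → S => h ⟨n, Finset.mem_Iic.2 le_rfl⟩)
      (measurable_pi_apply _)) 0 (fun _ => s)

/-- The expected return time to `s` of the chain started in `s`. -/
noncomputable def meanReturnTime (q : S → S → ℝ≥0∞) (s : S) : ℝ≥0∞ :=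
  ∫⁻ ω, returnTime q s ω.1 ω.2
    ∂((jumpChainLaw q s).prod (Measure.infinitePi fun _ : ℕ => expMeasure 1))

/-- The state `s` is positive recurrent: its expected return time is finite (or the chain never
leaves it). -/
def PositiveRecurrentAt (q : S → S → ℝ≥0∞) (s : S) : Prop :=
  exitRate q s = 0 ∨ meanReturnTime q s < ∞

/-- The chain started in `s₀`, whose state space consists of the states that can be reached from
`s₀`, is positive recurrent. -/
def PositiveRecurrentFrom (q : S → S → ℝ≥0∞) (s₀ : S) : Prop :=
  ∀ s, Reachable q s₀ s → PositiveRecurrentAt q s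

end

end MarkovJump

/-! ### The network with two base stations

Base stations and hotspots are both indexed by `Fin 2`, base station `i` being at the centre of
hotspot `i`. Data rates are indexed by `Fin 2` too: `0` is the NLoS rate and `1` the LoS rate. -/

/-- The parameters of the network. -/
structure TwoBSNetwork where
  /-- arrival rate of users -/
  lam : ℝ
  /-- parameter of the exponentially distributed file sizes -/
  mu : ℝ
  /-- `p k`: probability that an arriving user is in hotspot `k` -/
  p : Fin 2 → ℝ
  /-- `c 0`: NLoS data rate; `c 1`: LoS data rate -/
  c : Fin 2 → ℝ
  /-- `m i`: number of RF chains of base station `i` -/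
  m : Fin 2 → ℕ
  lam_pos : 0 < lam
  mu_pos : 0 < mu
  p_nonneg : ∀ k, 0 ≤ p k
  p_sum : p 0 + p 1 = 1
  c_pos : 0 < c 0
  c_lt : c 0 < c 1
  m_pos : ∀ i, 1 ≤ m i

namespace TwoBSNetwork

/-- `s i r` is the number of users associated with base station `i` at rate `c r`. -/
abbrev State := Fin 2 → Fin 2 → ℕ

/-- An association policy: given the current state and the hotspot of an arriving user, the
distribution of the base station that the user associates with. -/
abbrev Policy := State → Fin 2 → PMF (Fin 2)

/-- The empty network. -/
def emptyState : State := fun _ _ => 0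

/-- The state `s` with one more user at base station `i` with rate `c r`. -/
def addUser (s : State) (i r : Fin 2) : State :=
  fun j r' => s j r' + if j = i ∧ r' = r then 1 else 0

/-- The index of the rate at which a user in hotspot `k` can associate with base station `i`. -/
def rateIndex (k i : Fin 2) : Fin 2 := if i = k then 1 else 0

/-- The number of users associated with base station `i`. -/
def load (s : State) (i : Fin 2) : ℕ := s i 0 + s i 1

variable (N : TwoBSNetwork)

/-- The probability that a user arriving in state `s` joins base station `i` at rate `c r`. -/
noncomputable def joinProb (π : Policy) (s : State) (i r : Fin 2) : ℝ :=
  ∑ k : Fin 2, if rateIndex k i = r then N.p k * (π s k i).toReal else 0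

/-- The throughput of a user associated with base station `i` at rate `c r`. -/
noncomputable def throughput (s : State) (i r : Fin 2) : ℝ :=
  min (N.m i : ℝ) (load s i : ℝ) * (N.c r / (load s i : ℝ))

/-- The rate of jumps from the state `s` to the state `t`: a user arrives and joins base station `i`
at rate `c r`, or one of the users of base station `i` with rate `c r` completes its file and
departs. -/
noncomputable def jumpRate (π : Policy) (s t : State) : ℝ≥0∞ :=
  ∑ i : Fin 2, ∑ r : Fin 2,
    ((if t = addUser s i r then ENNReal.ofReal (N.lam * N.joinProb π s i r) else 0) +
      (if s = addUser t i r then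
        ENNReal.ofReal (N.mu * ((s i r : ℝ) * N.throughput s i r)) else 0))

/-- The system, started empty, is stable under the policy `π`: the induced continuous time Markov
chain is positive recurrent. -/
def StableUnder (π : Policy) : Prop :=
  MarkovJump.PositiveRecurrentFrom (N.jumpRate π) emptyState

end TwoBSNetwork

/-! Write `c` for `N.c 1`, and let `a` be the hotspot with the larger probability, `b` the other
one. With one RF chain, a busy base station removes work (a user at rate `c r` counting for `1 / c
r`) at mean rate `μ`, whatever its mix of users. Stability is thus a question of work input against
the speed `μ` of each station.

Sufficiency: serve all users of `b` at home and a fraction `α` of those of `a` at home, with `α`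
equalising the two work inputs. Both are then `λ (p_a c + p_b) / (c (1 + c))`, which is below `μ`
exactly when `λ < λ*`. The sum of squared workloads then has negative drift off a finite set, and
Foster's criterion applies (`stableUnder_of_load_lt`).

Necessity: weight the work at `a` by `c` and the work at `b` by `1`. A user of `a` brings weighted
work `1` wherever it goes; a user of `b` brings at least `1 / c`. For `λ ≥ λ*` every policy
therefore gives the weighted workload a non-negative drift. Its expectation before the return to the
empty state does not decay, although it grows by at most a constant per jump; so the probability of
no return within `n` jumps is at least of order `1 / n`, and the mean return time is infinite
(`not_stableUnder_of_le_load`). This covers the critical case `λ = λ*` as well.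

Total jump rates lie between two positive constants, so mean return times may be replaced by mean
numbers of jumps, and everything is proved for the embedded chain. -/

namespace MarkovJump

/-! ### Return times compared with sums over paths that have not returned -/

section

variable {S : Type*}

open scoped Classical in
/-- The indicator function of the paths that avoid `s` at the times `1, …, n`. -/
noncomputable def avoid (s : S) (n : ℕ) (y : ℕ → S) : ℝ≥0∞ :=
  ∏ k ∈ Finset.range n, if y (k + 1) = s then 0 else 1

lemma avoid_succ (s : S) (n : ℕ) (y : ℕ → S) [Decidable (y (n + 1) = s)] :
    avoid s (n + 1) y = avoid s n y * if y (n + 1) = s then 0 else 1 := by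
  rw [avoid, Finset.prod_range_succ, avoid]
  congr

lemma avoid_eq_one {s : S} {n : ℕ} {y : ℕ → S} (h : ∀ k, 1 ≤ k → k ≤ n → y k ≠ s) :
    avoid s n y = 1 :=
  Finset.prod_eq_one fun k hk => if_neg (h _ (by omega) (by simpa using hk))

lemma avoid_eq_zero {s : S} {n m : ℕ} {y : ℕ → S} (hm : 1 ≤ m) (hmn : m ≤ n) (h : y m = s) :
    avoid s n y = 0 := by
  obtain ⟨k, rfl⟩ : ∃ k, m = k + 1 := ⟨m - 1, by omega⟩
  exact Finset.prod_eq_zero (i := k) (by simpa using hmn) (if_pos h)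

lemma avoid_eq_zero_or_one (s : S) (n : ℕ) (y : ℕ → S) : avoid s n y = 0 ∨ avoid s n y = 1 := by
  by_cases h : ∀ k, 1 ≤ k → k ≤ n → y k ≠ s
  · exact Or.inr (avoid_eq_one h)
  · push Not at h
    obtain ⟨k, h1, h2, h3⟩ := h
    exact Or.inl (avoid_eq_zero h1 h2 h3)

/-- Up to the return, `avoid` is `1` and each holding time is at least `e n / hi`. Without a return
the infimum is `∞`, so nothing is assumed of the path. -/
lemma tsum_avoid_div_le_returnTime (q : S → S → ℝ≥0∞) (s : S) {hi : ℝ≥0∞}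
    (hhi : ∀ x, exitRate q x ≤ hi) (y : ℕ → S) (e : ℕ → ℝ) :
    (∑' n, avoid s n y * ENNReal.ofReal (e n)) / hi ≤ returnTime q s y e := by
  refine le_iInf₂ fun n hn => ?_
  have : ∑' k, avoid s k y * ENNReal.ofReal (e k) =
      ∑ k ∈ Finset.range n, avoid s k y * ENNReal.ofReal (e k) := by
    refine tsum_eq_sum fun k hk => ?_
    rw [avoid_eq_zero hn.1 (by simpa using hk) hn.2, zero_mul]
  rw [this, jumpTime, div_eq_mul_inv, Finset.sum_mul]
  refine Finset.sum_le_sum fun k _ => ?_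
  rw [div_eq_mul_inv]
  gcongr
  · rcases avoid_eq_zero_or_one s k y with h | h <;> simp [h]
  · exact hhi _

/-- Here a return must be assumed: otherwise the left side is `∞` while the holding times might be
summable. -/
lemma returnTime_le_tsum_avoid_div (q : S → S → ℝ≥0∞) (s : S) {lo : ℝ≥0∞}
    (hlo : ∀ x, lo ≤ exitRate q x) (y : ℕ → S) (e : ℕ → ℝ) (hy : ∃ n, 1 ≤ n ∧ y n = s) :
    returnTime q s y e ≤ (∑' n, avoid s n y * ENNReal.ofReal (e n)) / lo := by
  classical
  have hn := Nat.find_spec hy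
  have hmin : ∀ k, 1 ≤ k → k < Nat.find hy → y k ≠ s :=
    fun k h1 h2 h3 => Nat.find_min hy h2 ⟨h1, h3⟩
  refine (iInf₂_le (Nat.find hy) hn).trans ?_
  rw [jumpTime, div_eq_mul_inv]
  refine le_trans ?_ (mul_le_mul_left (ENNReal.sum_le_tsum (Finset.range (Nat.find hy))) _)
  rw [Finset.sum_mul]
  refine Finset.sum_le_sum fun k hk => ?_
  rw [avoid_eq_one fun j h1 h2 => hmin j h1 (h2.trans_lt (by simpa using hk)), one_mul,
    div_eq_mul_inv]
  gcongr
  exact hlo _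

/-! ### Markov property and expectations before the return -/

variable [MeasurableSpace S] [DiscreteMeasurableSpace S]

lemma measurable_avoid (s : S) (n : ℕ) : Measurable (avoid s n) := by
  refine Finset.measurable_prod _ fun k _ => ?_
  exact (Measurable.of_discrete (f := fun t : S => open scoped Classical in
    if t = s then (0 : ℝ≥0∞) else 1)).comp (measurable_pi_apply (k + 1))

instance (q : S → S → ℝ≥0∞) (s : S) : IsProbabilityMeasure (jumpChainLaw q s) := by
  unfold jumpChainLaw; infer_instance

/-- The Markov property of the embedded chain: given the path up to time `n`, the state at time
`n + 1` is distributed according to the transition kernel. -/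
lemma lintegral_jumpChainLaw_succ (q : S → S → ℝ≥0∞) (s : S) (n : ℕ)
    (h : ((i : Finset.Iic n) → S) → ℝ≥0∞) (hh : Measurable h) (g : S → ℝ≥0∞) :
    ∫⁻ y, h (Preorder.frestrictLe n y) * g (y (n + 1)) ∂jumpChainLaw q s =
      ∫⁻ y, h (Preorder.frestrictLe n y) * ∫⁻ t, g t ∂jumpKernel q (y n) ∂jumpChainLaw q s := by
  have hg : Measurable g := Measurable.of_discrete
  unfold jumpChainLaw
  set κ : (n : ℕ) → Kernel ((i : Finset.Iic n) → S) S := fun n => (jumpKernel q).comap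
      (fun h : (i : Finset.Iic n) → S => h ⟨n, Finset.mem_Iic.2 le_rfl⟩)
      (measurable_pi_apply _) with hκ
  set x₀ : (i : Finset.Iic 0) → S := fun _ => s
  have key := Kernel.partialTraj_compProd_eq_map_traj (X := fun _ : ℕ => S) (κ := κ)
    (Nat.zero_le n) (x₀ := x₀)
  have hm : Measurable fun p : ((i : Finset.Iic n) → S) × S => h p.1 * g p.2 := by fun_prop
  have h1 := congrArg (fun m => ∫⁻ p, h p.1 * g p.2 ∂m) key
  rw [Measure.lintegral_compProd hm, lintegral_map hm (by fun_prop)] at h1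
  rw [← h1, ← Kernel.traj_map_frestrictLe_apply, lintegral_map]
  · exact lintegral_congr fun y =>
      lintegral_const_mul (μ := jumpKernel q (y n)) (h (Preorder.frestrictLe n y)) hg
  · exact Measurable.lintegral_kernel_prod_right' (κ := κ n) hm
  · fun_prop

lemma jumpChainLaw_zero (q : S → S → ℝ≥0∞) (s : S) (f : S → ℝ≥0∞) :
    ∫⁻ y, f (y 0) ∂jumpChainLaw q s = f s := by
  have hf : Measurable f := Measurable.of_discrete
  unfold jumpChainLaw
  rw [Kernel.lintegral_traj _ (by fun_prop)]
  simp [Function.updateFinset]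

/-- The expectation of `f (y n)` on the event that the embedded chain `y`, started in `s`, has not
returned to `s` up to time `n`. -/
noncomputable def taboo (q : S → S → ℝ≥0∞) (s : S) (n : ℕ) (f : S → ℝ≥0∞) : ℝ≥0∞ :=
  ∫⁻ y, avoid s n y * f (y n) ∂jumpChainLaw q s

lemma taboo_zero (q : S → S → ℝ≥0∞) (s : S) (f : S → ℝ≥0∞) : taboo q s 0 f = f s := by
  simp [taboo, avoid, jumpChainLaw_zero]

open scoped Classical in
lemma taboo_succ (q : S → S → ℝ≥0∞) (s : S) (n : ℕ) (f : S → ℝ≥0∞) :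
    taboo q s (n + 1) f =
      taboo q s n fun x => ∫⁻ t, (if t = s then 0 else f t) ∂jumpKernel q x := by
  -- Extending a finite history to a full path (the filler `s` is never inspected) makes `avoid s n`
  -- a function of the history, as the Markov property requires.
  set e : ((i : Finset.Iic n) → S) → ℕ → S :=
    fun x k => if hk : k ≤ n then x ⟨k, Finset.mem_Iic.2 hk⟩ else s with he
  have hem : Measurable e := by
    refine measurable_pi_iff.2 fun k => ?_
    by_cases hk : k ≤ n
    · simpa [he, hk] using measurable_pi_apply _
    · simp [he, hk]
  have hav : ∀ y : ℕ → S, avoid s n (e (Preorder.frestrictLe n y)) = avoid s n y := fun y => by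
    refine Finset.prod_congr rfl fun k hk => ?_
    simp [he, show k + 1 ≤ n by simpa using hk]
  have := lintegral_jumpChainLaw_succ q s n (fun x => avoid s n (e x))
    ((measurable_avoid s n).comp hem) (fun t => if t = s then 0 else f t)
  simp only [hav] at this
  rw [taboo, taboo, ← this]
  refine lintegral_congr fun y => ?_
  rw [avoid_succ]
  split_ifs <;> simp

lemma taboo_mono (q : S → S → ℝ≥0∞) (s : S) (n : ℕ) {f g : S → ℝ≥0∞} (h : ∀ x, f x ≤ g x) :
    taboo q s n f ≤ taboo q s n g :=
  lintegral_mono fun _ => mul_le_mul_right (h _) _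

/-- From time `1` on, paths sitting at `s` have weight zero. At time `0` the chain is at `s` itself,
hence the index `n + 1`. -/
lemma taboo_mono_of_ne (q : S → S → ℝ≥0∞) (s : S) (n : ℕ) {f g : S → ℝ≥0∞}
    (h : ∀ x, x ≠ s → f x ≤ g x) : taboo q s (n + 1) f ≤ taboo q s (n + 1) g := by
  classical
  refine lintegral_mono fun y => ?_
  by_cases hy : y (n + 1) = s
  · simp [avoid_succ, hy]
  · exact mul_le_mul_right (h _ hy) _

lemma taboo_add (q : S → S → ℝ≥0∞) (s : S) (n : ℕ) (f g : S → ℝ≥0∞) :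
    taboo q s n (fun x => f x + g x) = taboo q s n f + taboo q s n g := by
  have hf : Measurable f := Measurable.of_discrete
  have hm := measurable_avoid s n
  simp only [taboo, mul_add]
  exact lintegral_add_left (by fun_prop) _

lemma taboo_const_mul (q : S → S → ℝ≥0∞) (s : S) (n : ℕ) (c : ℝ≥0∞) (f : S → ℝ≥0∞) :
    taboo q s n (fun x => c * f x) = c * taboo q s n f := by
  have hf : Measurable f := Measurable.of_discrete
  have hm := measurable_avoid s n
  simp only [taboo, mul_left_comm _ c]
  exact lintegral_const_mul _ (by fun_prop)

/-! ### From expected return time to expected number of jumps -/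

lemma lintegral_ofReal_expMeasure : ∫⁻ x, ENNReal.ofReal x ∂expMeasure 1 = 1 := by
  have h0 : expMeasure 1 = volume.withDensity (exponentialPDF 1) := rfl
  have hm : Measurable (exponentialPDF 1) := by
    unfold exponentialPDF; fun_prop
  rw [h0, lintegral_withDensity_eq_lintegral_mul _ hm (by fun_prop)]
  -- The exponent `2 - 1` puts the integrand in the form of the integral for `Γ(2) = 1`.
  have h1 : ∀ x : ℝ, (exponentialPDF 1 * fun x => ENNReal.ofReal x) x =
      (Set.Ioi (0 : ℝ)).indicator (fun x => ENNReal.ofReal (Real.exp (-x) * x ^ ((2 : ℝ) - 1))) x := by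
    intro x
    rcases le_or_gt x 0 with hx | hx
    · simp [not_lt.2 hx, ENNReal.ofReal_of_nonpos hx]
    · simp only [Pi.mul_apply, Set.indicator, Set.mem_Ioi, hx, if_true]
      rw [exponentialPDF_of_nonneg hx.le, ← ENNReal.ofReal_mul (by positivity)]
      norm_num
  rw [lintegral_congr h1, lintegral_indicator measurableSet_Ioi,
    ← ofReal_integral_eq_lintegral_ofReal (Real.GammaIntegral_convergent (by norm_num)),
    ← Real.Gamma_eq_integral (by norm_num)]
  · simp
  · filter_upwards [ae_restrict_mem measurableSet_Ioi] with x hx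
    have : (0 : ℝ) < x := hx
    positivity

lemma lintegral_avoid_mul_holding (q : S → S → ℝ≥0∞) (s : S) (n : ℕ) :
    ∫⁻ ω, avoid s n ω.1 * ENNReal.ofReal (ω.2 n)
      ∂((jumpChainLaw q s).prod (Measure.infinitePi fun _ : ℕ => expMeasure 1)) =
      taboo q s n 1 := by
  have : IsProbabilityMeasure (expMeasure 1) := isProbabilityMeasure_expMeasure one_pos
  have hm := measurable_avoid s n
  rw [lintegral_prod_mul (f := avoid s n) (g := fun e : ℕ → ℝ => ENNReal.ofReal (e n))
    hm.aemeasurable (ENNReal.measurable_ofReal.comp (measurable_pi_apply n)).aemeasurable]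
  have h2 : ∫⁻ e : ℕ → ℝ, ENNReal.ofReal (e n) ∂(Measure.infinitePi fun _ : ℕ => expMeasure 1)
      = 1 := by
    rw [← lintegral_ofReal_expMeasure, ← Measure.infinitePi_map_eval (fun _ : ℕ => expMeasure 1) n,
      lintegral_map (by fun_prop) (by fun_prop)]
    rw [Measure.infinitePi_map_eval (fun _ : ℕ => expMeasure 1) n]
  rw [h2]
  simp [taboo]

/-- The expected number of jumps until the return, computed as the sum of the tail
probabilities. -/
noncomputable def meanReturnSteps (q : S → S → ℝ≥0∞) (s : S) : ℝ≥0∞ := ∑' n, taboo q s n 1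

lemma lintegral_tsum_avoid (q : S → S → ℝ≥0∞) (s : S) :
    ∫⁻ ω, ∑' n, avoid s n ω.1 * ENNReal.ofReal (ω.2 n)
      ∂((jumpChainLaw q s).prod (Measure.infinitePi fun _ : ℕ => expMeasure 1)) =
      meanReturnSteps q s := by
  rw [lintegral_tsum, meanReturnSteps]
  · exact tsum_congr fun n => lintegral_avoid_mul_holding q s n
  · intro n
    have hm := measurable_avoid s n
    fun_prop

/-- On a path that never returns, `∑ avoid` is infinite; its expectation is finite. -/
lemma ae_exists_return (q : S → S → ℝ≥0∞) (s : S) (h : meanReturnSteps q s < ∞) :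
    ∀ᵐ y ∂jumpChainLaw q s, ∃ n, 1 ≤ n ∧ y n = s := by
  have h1 : ∫⁻ y, ∑' n, avoid s n y ∂jumpChainLaw q s < ∞ := by
    rw [lintegral_tsum fun n => (measurable_avoid s n).aemeasurable]
    simpa [meanReturnSteps, taboo] using h
  filter_upwards [ae_lt_top (Measurable.tsum fun n => measurable_avoid s n) h1.ne]
    with y hy
  by_contra! hcon
  have : ∀ n, avoid s n y = 1 := fun n => avoid_eq_one fun k hk _ => hcon k hk
  simp [this] at hy

lemma meanReturnTime_lt_top (q : S → S → ℝ≥0∞) (s : S) {lo : ℝ≥0∞} (h0 : lo ≠ 0)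
    (hlo : ∀ x, lo ≤ exitRate q x) (h : meanReturnSteps q s < ∞) : meanReturnTime q s < ∞ := by
  have : IsProbabilityMeasure (expMeasure 1) := isProbabilityMeasure_expMeasure one_pos
  have hle : meanReturnTime q s ≤ meanReturnSteps q s * lo⁻¹ := by
    rw [← lintegral_tsum_avoid, ← lintegral_mul_const _ (by
      refine Measurable.tsum fun n => ?_
      have hm := measurable_avoid s n
      fun_prop)]
    refine lintegral_mono_ae ?_
    filter_upwards [Measure.quasiMeasurePreserving_fst.ae (ae_exists_return q s h)] with ω hω
    exact returnTime_le_tsum_avoid_div q s hlo _ _ hω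
  exact hle.trans_lt (ENNReal.mul_lt_top h (by simpa [pos_iff_ne_zero] using h0))

lemma meanReturnSteps_lt_top (q : S → S → ℝ≥0∞) (s : S) {hi : ℝ≥0∞} (h0 : hi ≠ ∞)
    (hhi : ∀ x, exitRate q x ≤ hi) (h : meanReturnTime q s < ∞) : meanReturnSteps q s < ∞ := by
  have hle : meanReturnSteps q s * hi⁻¹ ≤ meanReturnTime q s := by
    rw [← lintegral_tsum_avoid, ← lintegral_mul_const _ (by
      refine Measurable.tsum fun n => ?_
      have hm := measurable_avoid s n
      fun_prop)]
    exact lintegral_mono fun ω => tsum_avoid_div_le_returnTime q s hhi _ _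
  by_contra hcon
  rw [not_lt, top_le_iff] at hcon
  rw [hcon, ENNReal.top_mul (by simpa using h0)] at hle
  exact absurd h (not_lt.2 hle)

end

/-! ### Foster's criterion -/

section

variable {S : Type*} [MeasurableSpace S] [DiscreteMeasurableSpace S]

/-- Foster's criterion for the return to a single state. -/
lemma meanReturnSteps_lt_top_of_drift {q : S → S → ℝ≥0∞} {s : S} (F : S → ℝ≥0∞)
    (hF : ∀ x, x ≠ s → ∫⁻ t, F t ∂jumpKernel q x + 1 ≤ F x)
    (hs : ∫⁻ t, F t ∂jumpKernel q s < ∞) : meanReturnSteps q s < ∞ := by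
  classical
  have hle : ∀ x, ∫⁻ t, (if t = s then 0 else F t) ∂jumpKernel q x ≤
      ∫⁻ t, F t ∂jumpKernel q x := fun x => lintegral_mono fun t => by
    beta_reduce; split_ifs <;> simp
  -- Each step before the return costs one unit of `F`; these inequalities telescope.
  have step : ∀ n, taboo q s (n + 1) 1 + taboo q s (n + 2) F ≤ taboo q s (n + 1) F := by
    intro n
    rw [taboo_succ q s (n + 1), add_comm, ← taboo_add]
    exact taboo_mono_of_ne q s n fun x hx => (add_le_add_left (hle x) _).trans (hF x hx)
  have hsum : ∀ n, ∑ k ∈ Finset.range n, taboo q s (k + 1) 1 + taboo q s (n + 1) F ≤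
      taboo q s 1 F := by
    intro n
    induction n with
    | zero => simp
    | succ n ih =>
      rw [Finset.sum_range_succ, add_assoc]
      exact (add_le_add_right (step n) _).trans ih
  have h1 : taboo q s 1 F ≤ ∫⁻ t, F t ∂jumpKernel q s := by
    rw [taboo_succ, taboo_zero]
    exact hle s
  rw [meanReturnSteps, tsum_eq_zero_add' ENNReal.summable, taboo_zero]
  refine ENNReal.add_lt_top.2 ⟨ENNReal.one_lt_top, lt_of_le_of_lt ?_ hs⟩
  exact ENNReal.tsum_le_of_sum_range_le fun n => (le_self_add.trans (hsum n)).trans h1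

open scoped Classical in
/-- `survival q s n x` is the probability that the embedded chain started in `x` does not visit `s`
at the times `0, …, n`. -/
noncomputable def survival (q : S → S → ℝ≥0∞) (s : S) : ℕ → S → ℝ≥0∞
  | 0 => fun x => if x = s then 0 else 1
  | n + 1 => fun x => if x = s then 0 else ∫⁻ t, survival q s n t ∂jumpKernel q x

lemma survival_self (q : S → S → ℝ≥0∞) (s : S) (n : ℕ) : survival q s n s = 0 := by
  cases n <;> simp [survival]

lemma survival_zero_of_ne (q : S → S → ℝ≥0∞) {s x : S} (h : x ≠ s) : survival q s 0 x = 1 := by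
  simp [survival, h]

lemma survival_succ_of_ne (q : S → S → ℝ≥0∞) {s x : S} (h : x ≠ s) (n : ℕ) :
    survival q s (n + 1) x = ∫⁻ t, survival q s n t ∂jumpKernel q x := by
  simp [survival, h]

lemma survival_le_one (q : S → S → ℝ≥0∞) (s : S) (n : ℕ) (x : S) : survival q s n x ≤ 1 := by
  induction n generalizing x with
  | zero => simp only [survival]; split_ifs <;> simp
  | succ n ih =>
    by_cases h : x = s
    · simp [h, survival_self]
    · rw [survival_succ_of_ne q h]
      exact (lintegral_mono ih).trans (by simp)

lemma survival_antitone (q : S → S → ℝ≥0∞) (s x : S) : Antitone fun n => survival q s n x := by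
  refine antitone_nat_of_succ_le fun n => ?_
  induction n generalizing x with
  | zero =>
    by_cases h : x = s
    · simp [h, survival_self]
    · rw [survival_zero_of_ne q h]
      exact survival_le_one q s _ x
  | succ n ih =>
    by_cases h : x = s
    · simp [h, survival_self]
    · rw [survival_succ_of_ne q h, survival_succ_of_ne q h]
      exact lintegral_mono ih

variable [Countable S]

omit [Countable S] in
lemma jumpKernel_singleton {q : S → S → ℝ≥0∞} {x : S} (h0 : exitRate q x ≠ 0)
    (h1 : exitRate q x ≠ ∞) (t : S) : jumpKernel q x {t} = q x t * (exitRate q x)⁻¹ := by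
  change (jumpPMF q x).toMeasure {t} = _
  rw [PMF.toMeasure_apply_singleton _ _ (measurableSet_singleton t), jumpPMF, dif_pos ⟨h0, h1⟩]
  exact PMF.normalize_apply _ _ t

lemma exitRate_mul_lintegral_jumpKernel {q : S → S → ℝ≥0∞} {x : S} (h0 : exitRate q x ≠ 0)
    (h1 : exitRate q x ≠ ∞) (f : S → ℝ≥0∞) :
    exitRate q x * ∫⁻ t, f t ∂jumpKernel q x = ∑' t, q x t * f t := by
  rw [lintegral_countable', ← ENNReal.tsum_mul_left]
  refine tsum_congr fun t => ?_
  rw [jumpKernel_singleton h0 h1, show exitRate q x * (f t * (q x t * (exitRate q x)⁻¹)) =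
    (exitRate q x * (exitRate q x)⁻¹) * (q x t * f t) by ring, ENNReal.mul_inv_cancel h0 h1, one_mul]

lemma ae_jumpKernel_rate_ne_zero {q : S → S → ℝ≥0∞} {x : S} (h0 : exitRate q x ≠ 0)
    (h1 : exitRate q x ≠ ∞) : ∀ᵐ t ∂jumpKernel q x, q x t ≠ 0 := by
  rw [ae_iff_of_countable]
  intro t ht
  rw [jumpKernel_singleton h0 h1] at ht
  exact left_ne_zero_of_mul ht

/-- Induction along a path to `s`: if its next state `y` can still hit `s`, the positive mass sent
to `y` makes the average from `x` strictly less than `1`. -/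
lemma exists_survival_lt_one {q : S → S → ℝ≥0∞} (h0 : ∀ x, exitRate q x ≠ 0)
    (h1 : ∀ x, exitRate q x ≠ ∞) {s x : S} (h : Reachable q x s) : ∃ n, survival q s n x < 1 := by
  induction h using Relation.ReflTransGen.head_induction_on with
  | refl => exact ⟨0, by simp [survival_self]⟩
  | @head x y hxy _ ih =>
    obtain ⟨n, hn⟩ := ih
    refine ⟨n + 1, ?_⟩
    by_cases hx : x = s
    · simp [hx, survival_self]
    rw [survival_succ_of_ne q hx]
    have key : exitRate q x * ∫⁻ t, survival q s n t ∂jumpKernel q x < exitRate q x * 1 := by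
      rw [exitRate_mul_lintegral_jumpKernel (h0 x) (h1 x), mul_one]
      have hq : q x y ≠ ∞ := ne_top_of_le_ne_top (h1 x) (ENNReal.le_tsum y)
      have hle : ∀ t, q x t * survival q s n t ≤ q x t := fun t =>
        mul_le_of_le_one_right' (survival_le_one q s n t)
      refine ENNReal.tsum_lt_tsum (i := y) (ne_top_of_le_ne_top (h1 x) (ENNReal.tsum_le_tsum hle))
        hle ?_
      simpa using (ENNReal.mul_lt_mul_iff_right hxy.ne' hq).2 hn
    exact lt_of_mul_lt_mul_left' key

/-- Foster's criterion for the return to a state that can be reached from everywhere. -/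
theorem meanReturnSteps_lt_top_of_foster {q : S → S → ℝ≥0∞} (h0 : ∀ x, exitRate q x ≠ 0)
    (h1 : ∀ x, exitRate q x ≠ ∞) {s : S} (hreach : ∀ x, Reachable q x s) (V : S → ℝ≥0∞)
    (hVtop : ∀ x, V x ≠ ∞) {C : Set S} (hC : C.Finite)
    (hdrift : ∀ x, x ∉ C → ∫⁻ t, V t ∂jumpKernel q x + 1 ≤ V x) {M : ℝ≥0∞} (hM : M ≠ ∞)
    (hbdd : ∀ x, ∫⁻ t, V t ∂jumpKernel q x ≤ V x + M) : meanReturnSteps q s < ∞ := by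
  choose n hn using fun x => exists_survival_lt_one h0 h1 (hreach x)
  obtain ⟨T, hT⟩ : ∃ T, ∀ x ∈ C, survival q s T x < 1 := by
    obtain ⟨T, hT⟩ := (hC.image n).bddAbove
    exact ⟨T, fun x hx =>
      (survival_antitone q s x (hT (Set.mem_image_of_mem n hx))).trans_lt (hn x)⟩
  obtain ⟨η, hη1, hη⟩ : ∃ η < 1, ∀ x ∈ C, survival q s T x ≤ η := by
    refine ⟨hC.toFinset.sup (survival q s T), ?_, fun x hx =>
      Finset.le_sup (f := survival q s T) (by simpa using hx)⟩
    rw [Finset.sup_lt_iff (by simp)]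
    exact fun x hx => hT x (by simpa using hx)
  have hδ : 1 - η ≠ 0 := (tsub_pos_of_lt hη1).ne'
  have hδ' : 1 - η ≠ ∞ := ne_top_of_le_ne_top ENNReal.one_ne_top tsub_le_self
  have hηtop : η ≠ ∞ := hη1.ne_top
  -- The corrector `g` below is the mean of the hitting time of `s` capped at `T`. Its drift is at
  -- most `-(1 - η)` on `C` outside `s`, so adding `K * g` absorbs the possible increase `M` there
  -- and leaves a drift of `-1`.
  set K := (M + 1) / (1 - η) with hK
  have hKδ : K * (1 - η) = M + 1 := ENNReal.div_mul_cancel hδ hδ'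
  have hKtop : K ≠ ∞ := ENNReal.div_ne_top (by simp [hM]) hδ
  set g : S → ℝ≥0∞ := fun x => ∑ k ∈ Finset.range T, survival q s k x with hg
  have hgint : ∀ x, ∫⁻ t, (V t + K * g t) ∂jumpKernel q x =
      ∫⁻ t, V t ∂jumpKernel q x + K * ∫⁻ t, g t ∂jumpKernel q x := fun x => by
    rw [lintegral_add_left Measurable.of_discrete, lintegral_const_mul _ Measurable.of_discrete]
  -- One step shifts the survival index, so the two sums telescope.
  have hg1 : ∀ x, x ≠ s → ∫⁻ t, g t ∂jumpKernel q x + 1 = g x + survival q s T x := by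
    intro x hx
    simp only [hg]
    rw [lintegral_finsetSum _ fun k _ => Measurable.of_discrete, ← Finset.sum_range_succ,
      Finset.sum_range_succ', survival_zero_of_ne q hx]
    simp only [survival_succ_of_ne q hx]
  have hgT : ∀ x, g x ≤ T := fun x =>
    (Finset.sum_le_sum fun k _ => survival_le_one q s k x).trans (by simp)
  refine meanReturnSteps_lt_top_of_drift (fun x => V x + K * g x) (fun x hx => ?_) ?_
  · rw [hgint]
    by_cases hxC : x ∈ C
    · have h2 : ∫⁻ t, g t ∂jumpKernel q x + (1 - η) ≤ g x := by
        refine (ENNReal.add_le_add_iff_right hηtop).1 ?_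
        rw [add_assoc, tsub_add_cancel_of_le hη1.le, hg1 x hx]
        exact add_le_add_right (hη x hxC) _
      calc _ ≤ V x + M + K * ∫⁻ t, g t ∂jumpKernel q x + 1 := by gcongr; exact hbdd x
        _ = V x + K * (∫⁻ t, g t ∂jumpKernel q x + (1 - η)) := by rw [mul_add, hKδ]; ring
        _ ≤ _ := by gcongr
    · have h2 : ∫⁻ t, g t ∂jumpKernel q x ≤ g x := by
        refine (ENNReal.add_le_add_iff_right ENNReal.one_ne_top).1 ?_
        rw [hg1 x hx]
        exact add_le_add_right (survival_le_one q s T x) _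
      calc _ = (∫⁻ t, V t ∂jumpKernel q x + 1) + K * ∫⁻ t, g t ∂jumpKernel q x := by ring
        _ ≤ _ := by gcongr; exact hdrift x hxC
  · rw [hgint]
    refine ENNReal.add_lt_top.2 ⟨(hbdd s).trans_lt (ENNReal.add_lt_top.2
      ⟨(hVtop s).lt_top, hM.lt_top⟩), ENNReal.mul_lt_top hKtop.lt_top ?_⟩
    exact (lintegral_mono hgT).trans_lt (by simp)

/-! ### Infinite mean return under non-negative drift -/

lemma tsum_inv_natCast_add_one : ∑' n : ℕ, ((n + 1 : ℕ) : ℝ≥0∞)⁻¹ = ∞ := by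
  by_contra h
  have h1 : ∀ n : ℕ, ((n + 1 : ℕ) : ℝ≥0∞)⁻¹ = (((n + 1 : ℕ) : NNReal)⁻¹ : NNReal) := fun n => by
    rw [ENNReal.coe_inv (by positivity), ENNReal.coe_natCast]
  simp only [h1] at h
  rw [← ne_eq, ENNReal.tsum_coe_ne_top_iff_summable, ← NNReal.summable_coe] at h
  refine Real.not_summable_natCast_inv ((summable_nat_add_iff 1).1 ?_)
  simpa using h

/-- A chain with bounded jumps and a non-negative drift does not have a finite mean return
time. -/
theorem meanReturnSteps_eq_top_of_drift {q : S → S → ℝ≥0∞} (h0 : ∀ x, exitRate q x ≠ 0)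
    (h1 : ∀ x, exitRate q x ≠ ∞) {s : S} (V : S → ℝ≥0∞) (hs : V s = 0)
    (hdrift : ∀ x, V x ≤ ∫⁻ t, V t ∂jumpKernel q x) (hpos : ∫⁻ t, V t ∂jumpKernel q s ≠ 0)
    {B : ℝ≥0∞} (hB : B ≠ ∞) (hjump : ∀ x y, q x y ≠ 0 → V y ≤ V x + B) :
    meanReturnSteps q s = ∞ := by
  classical
  have hV : ∀ x, ∫⁻ t, (if t = s then 0 else V t) ∂jumpKernel q x = ∫⁻ t, V t ∂jumpKernel q x :=
    fun x => lintegral_congr fun t => by split_ifs with h <;> simp [h, hs]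
  -- Killing the chain at `s` loses nothing because `V s = 0`.
  have hlow : ∀ n, ∫⁻ t, V t ∂jumpKernel q s ≤ taboo q s (n + 1) V := by
    intro n
    induction n with
    | zero => rw [taboo_succ, taboo_zero, hV]
    | succ n ih =>
      rw [taboo_succ]
      simp only [hV]
      exact ih.trans (taboo_mono _ _ _ hdrift)
  -- Encodes `V ≤ B * n` almost surely at time `n` through truncated subtraction.
  have hzero : ∀ n : ℕ, taboo q s n (fun x => V x - B * n) = 0 := by
    intro n
    induction n with
    | zero => simp [taboo_zero, hs]
    | succ n ih =>
      rw [taboo_succ]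
      refine le_antisymm (le_trans (taboo_mono _ _ _ fun x => ?_) ih.le) zero_le
      calc _ ≤ ∫⁻ _, (V x - B * n) ∂jumpKernel q x := by
            refine lintegral_mono_ae ?_
            filter_upwards [ae_jumpKernel_rate_ne_zero (h0 x) (h1 x)] with t ht
            by_cases hts : t = s
            · simp [hts]
            · rw [if_neg hts, tsub_le_iff_right]
              refine (hjump x t ht).trans ?_
              push_cast
              rw [mul_add, mul_one, ← add_assoc]
              gcongr
              exact le_tsub_add
        _ = V x - B * n := by simp
  have hup : ∀ n : ℕ, taboo q s n V ≤ B * n * taboo q s n 1 := by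
    intro n
    calc taboo q s n V ≤ taboo q s n (fun x => (V x - B * n) + B * n * 1) :=
          taboo_mono _ _ _ fun x => by simpa using le_tsub_add
      _ = B * n * taboo q s n 1 := by
        rw [taboo_add, hzero, zero_add, taboo_const_mul]
        rfl
  by_contra hcon
  -- `hlow` and `hup` bound the no-return probability below by a multiple of `1 / (n + 1)`; the
  -- harmonic series diverges.
  have hle : (∫⁻ t, V t ∂jumpKernel q s) * ∑' n : ℕ, ((n + 1 : ℕ) : ℝ≥0∞)⁻¹ ≤
      B * meanReturnSteps q s := by
    rw [← ENNReal.tsum_mul_left, meanReturnSteps, ← ENNReal.tsum_mul_left,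
      tsum_eq_zero_add' (f := fun n => B * taboo q s n 1) ENNReal.summable]
    refine le_add_left (ENNReal.tsum_le_tsum fun n => ?_)
    rw [← div_eq_mul_inv]
    refine ENNReal.div_le_of_le_mul ?_
    calc _ ≤ _ := (hlow n).trans (hup (n + 1))
      _ = _ := by ring
  rw [tsum_inv_natCast_add_one, ENNReal.mul_top hpos, top_le_iff] at hle
  exact ENNReal.mul_ne_top hB hcon hle

end

end MarkovJump

/-! ### Rates and generator of the network -/

namespace TwoBSNetwork

lemma sum_fin_two_of_ne {M : Type*} [AddCommMonoid M] {a b : Fin 2} (h : a ≠ b) (f : Fin 2 → M) :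
    ∑ i, f i = f a + f b := by
  fin_cases a <;> fin_cases b <;> simp_all [Fin.sum_univ_two, add_comm]

/-- The state `s` with one user less at base station `i` with rate `c r`. -/
def removeUser (s : State) (i r : Fin 2) : State :=
  fun j r' => s j r' - if j = i ∧ r' = r then 1 else 0

lemma removeUser_addUser (s : State) (i r : Fin 2) : removeUser (addUser s i r) i r = s := by
  funext j r'
  simp [removeUser, addUser]

lemma addUser_removeUser {s : State} {i r : Fin 2} (h : s i r ≠ 0) :
    addUser (removeUser s i r) i r = s := by
  funext j r'
  simp only [removeUser, addUser]
  split_ifs with hj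
  · obtain ⟨rfl, rfl⟩ := hj
    omega
  · rfl

lemma sum_addUser (s : State) (i r : Fin 2) :
    ∑ j, ∑ r', addUser s i r j r' = ∑ j, ∑ r', s j r' + 1 := by
  fin_cases i <;> fin_cases r <;> simp [addUser, Fin.sum_univ_two] <;> ring

variable (N : TwoBSNetwork) (π : Policy)

/-- The intensity of arrivals to base station `i` at rate `c r`. -/
noncomputable def arrivalRate (s : State) (i r : Fin 2) : ℝ := N.lam * N.joinProb π s i r

/-- The intensity of departures from base station `i` of users with rate `c r`. -/
noncomputable def departureRate (s : State) (i r : Fin 2) : ℝ :=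
  N.mu * ((s i r : ℝ) * N.throughput s i r)

/-- The total intensity of arrivals and departures. -/
noncomputable def totalRate (s : State) : ℝ :=
  ∑ i, ∑ r, (N.arrivalRate π s i r + N.departureRate s i r)

/-- The generator of the chain. -/
noncomputable def generator (v : State → ℝ) (s : State) : ℝ :=
  ∑ i, ∑ r, (N.arrivalRate π s i r * (v (addUser s i r) - v s) +
    N.departureRate s i r * (v (removeUser s i r) - v s))

variable {N π}

lemma c_pos' (r : Fin 2) : 0 < N.c r := by
  have h0 := N.c_pos
  have h1 := N.c_lt
  fin_cases r
  · exact h0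
  · exact h0.trans h1

lemma joinProb_nonneg (s : State) (i r : Fin 2) : 0 ≤ N.joinProb π s i r := by
  refine Finset.sum_nonneg fun k _ => ?_
  split_ifs
  · exact mul_nonneg (N.p_nonneg k) ENNReal.toReal_nonneg
  · exact le_rfl

lemma arrivalRate_nonneg (s : State) (i r : Fin 2) : 0 ≤ N.arrivalRate π s i r :=
  mul_nonneg N.lam_pos.le (joinProb_nonneg s i r)

lemma departureRate_nonneg (s : State) (i r : Fin 2) : 0 ≤ N.departureRate s i r := by
  have := N.mu_pos
  have := N.c_pos' r
  unfold departureRate throughput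
  positivity

lemma departureRate_eq_zero {s : State} {i r : Fin 2} (h : s i r = 0) :
    N.departureRate s i r = 0 := by
  simp [departureRate, h]

lemma load_pos {s : State} {i r : Fin 2} (h : s i r ≠ 0) : 0 < load s i := by
  unfold load
  fin_cases r <;> simp at h <;> omega

lemma departureRate_pos {s : State} {i r : Fin 2} (h : s i r ≠ 0) : 0 < N.departureRate s i r := by
  have := N.mu_pos
  have := N.c_pos' r
  have hl : (0 : ℝ) < load s i := by exact_mod_cast load_pos h
  have hs : (0 : ℝ) < s i r := by exact_mod_cast Nat.pos_of_ne_zero h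
  have hm : (0 : ℝ) < N.m i := by exact_mod_cast N.m_pos i
  unfold departureRate throughput
  positivity

lemma sum_toReal_pmf (p : PMF (Fin 2)) {a b : Fin 2} (h : a ≠ b) :
    (p a).toReal + (p b).toReal = 1 := by
  have hp := p.tsum_coe
  rw [tsum_fintype, sum_fin_two_of_ne h] at hp
  rw [← ENNReal.toReal_add (p.apply_ne_top a) (p.apply_ne_top b), hp, ENNReal.toReal_one]

lemma joinProb_one (s : State) {a b : Fin 2} (h : a ≠ b) :
    N.joinProb π s a 1 = N.p a * (π s a a).toReal := by
  rw [joinProb, sum_fin_two_of_ne h]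
  simp [rateIndex, h]

lemma joinProb_zero (s : State) {a b : Fin 2} (h : a ≠ b) :
    N.joinProb π s a 0 = N.p b * (π s b a).toReal := by
  rw [joinProb, sum_fin_two_of_ne h]
  simp [rateIndex, h]

lemma sum_arrivalRate (s : State) : ∑ i, ∑ r, N.arrivalRate π s i r = N.lam := by
  have h01 : (0 : Fin 2) ≠ 1 := by decide
  simp only [Fin.sum_univ_two, arrivalRate]
  rw [joinProb_one s h01, joinProb_one s h01.symm, joinProb_zero s h01, joinProb_zero s h01.symm]
  have h0 := sum_toReal_pmf (π s 0) h01
  have h1 := sum_toReal_pmf (π s 1) h01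
  linear_combination N.lam * N.p 0 * h0 + N.lam * N.p 1 * h1 + N.lam * N.p_sum

lemma lam_le_totalRate (s : State) : N.lam ≤ N.totalRate π s := by
  rw [← sum_arrivalRate (π := π) s]
  exact Finset.sum_le_sum fun i _ => Finset.sum_le_sum fun r _ =>
    le_add_of_nonneg_right (departureRate_nonneg s i r)

lemma totalRate_pos (s : State) : 0 < N.totalRate π s := N.lam_pos.trans_le (lam_le_totalRate s)

lemma tsum_jumpRate_mul (s : State) (f : State → ℝ≥0∞) :
    ∑' t, N.jumpRate π s t * f t =
      ∑ i, ∑ r, (ENNReal.ofReal (N.arrivalRate π s i r) * f (addUser s i r) +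
        ENNReal.ofReal (N.departureRate s i r) * f (removeUser s i r)) := by
  simp only [jumpRate, Finset.sum_mul, add_mul, ite_mul, zero_mul]
  rw [Summable.tsum_finsetSum fun _ _ => ENNReal.summable]
  refine Finset.sum_congr rfl fun i _ => ?_
  rw [Summable.tsum_finsetSum fun _ _ => ENNReal.summable]
  refine Finset.sum_congr rfl fun r _ => ?_
  rw [ENNReal.tsum_add]
  congr 1
  · rw [tsum_ite_eq]
    rfl
  · rw [tsum_eq_single (removeUser s i r)]
    -- If no such user is present, `removeUser` truncates to `s`, but the departure rate vanishes.
    · by_cases h : s i r = 0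
      · have h0 := departureRate_eq_zero (N := N) h
        unfold departureRate at h0
        simp [h0, departureRate]
      · rw [if_pos (addUser_removeUser h).symm]
        rfl
    · intro t ht
      refine if_neg fun h => ht ?_
      rw [h, removeUser_addUser]

lemma totalRate_mul_add_generator (v : State → ℝ) (s : State) :
    N.totalRate π s * v s + N.generator π v s =
      ∑ i, ∑ r, (N.arrivalRate π s i r * v (addUser s i r) +
        N.departureRate s i r * v (removeUser s i r)) := by
  simp only [totalRate, generator, Finset.sum_mul, ← Finset.sum_add_distrib]
  refine Finset.sum_congr rfl fun i _ => Finset.sum_congr rfl fun r _ => ?_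
  ring

lemma add_generator_div_nonneg (s : State) {v : State → ℝ} (hv : ∀ s, 0 ≤ v s) :
    0 ≤ v s + N.generator π v s / N.totalRate π s := by
  have hpos := totalRate_pos (N := N) (π := π) s
  rw [show v s + N.generator π v s / N.totalRate π s =
    (N.totalRate π s * v s + N.generator π v s) / N.totalRate π s by field_simp,
    totalRate_mul_add_generator]
  exact div_nonneg (Finset.sum_nonneg fun i _ => Finset.sum_nonneg fun r _ => add_nonneg
    (mul_nonneg (arrivalRate_nonneg s i r) (hv _))
    (mul_nonneg (departureRate_nonneg s i r) (hv _))) hpos.le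

lemma tsum_jumpRate_mul_ofReal (s : State) {v : State → ℝ} (hv : ∀ s, 0 ≤ v s) :
    ∑' t, N.jumpRate π s t * ENNReal.ofReal (v t) =
      ENNReal.ofReal (N.totalRate π s * v s + N.generator π v s) := by
  have h1 : ∀ i r, 0 ≤ N.arrivalRate π s i r * v (addUser s i r) :=
    fun i r => mul_nonneg (arrivalRate_nonneg s i r) (hv _)
  have h2 : ∀ i r, 0 ≤ N.departureRate s i r * v (removeUser s i r) :=
    fun i r => mul_nonneg (departureRate_nonneg s i r) (hv _)
  rw [tsum_jumpRate_mul, totalRate_mul_add_generator, ENNReal.ofReal_sum_of_nonneg fun i _ =>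
    Finset.sum_nonneg fun r _ => add_nonneg (h1 i r) (h2 i r)]
  refine Finset.sum_congr rfl fun i _ => ?_
  rw [ENNReal.ofReal_sum_of_nonneg fun r _ => add_nonneg (h1 i r) (h2 i r)]
  refine Finset.sum_congr rfl fun r _ => ?_
  rw [ENNReal.ofReal_add (h1 i r) (h2 i r), ENNReal.ofReal_mul (arrivalRate_nonneg s i r),
    ENNReal.ofReal_mul (departureRate_nonneg s i r)]

lemma exitRate_jumpRate (s : State) :
    MarkovJump.exitRate (N.jumpRate π) s = ENNReal.ofReal (N.totalRate π s) := by
  have := tsum_jumpRate_mul_ofReal (N := N) (π := π) s (v := fun _ => 1) fun _ => zero_le_one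
  simpa [generator, MarkovJump.exitRate] using this

lemma exitRate_jumpRate_ne_zero (s : State) : MarkovJump.exitRate (N.jumpRate π) s ≠ 0 := by
  rw [exitRate_jumpRate]
  exact (ENNReal.ofReal_pos.2 (totalRate_pos s)).ne'

lemma exitRate_jumpRate_ne_top (s : State) : MarkovJump.exitRate (N.jumpRate π) s ≠ ∞ := by
  rw [exitRate_jumpRate]
  exact ENNReal.ofReal_ne_top

/-- One step of the embedded chain, in terms of the generator. -/
lemma lintegral_jumpKernel_ofReal (s : State) {v : State → ℝ} (hv : ∀ s, 0 ≤ v s) :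
    ∫⁻ t, ENNReal.ofReal (v t) ∂MarkovJump.jumpKernel (N.jumpRate π) s =
      ENNReal.ofReal (v s + N.generator π v s / N.totalRate π s) := by
  have hpos := totalRate_pos (N := N) (π := π) s
  have h := MarkovJump.exitRate_mul_lintegral_jumpKernel
    (exitRate_jumpRate_ne_zero (N := N) (π := π) s) (exitRate_jumpRate_ne_top s)
    fun t => ENNReal.ofReal (v t)
  rw [tsum_jumpRate_mul_ofReal s hv, show N.totalRate π s * v s + N.generator π v s =
    N.totalRate π s * (v s + N.generator π v s / N.totalRate π s) by field_simp,
    ENNReal.ofReal_mul hpos.le, ← exitRate_jumpRate] at h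
  exact (ENNReal.mul_right_inj (exitRate_jumpRate_ne_zero s) (exitRate_jumpRate_ne_top s)).1 h

lemma eq_addUser_of_jumpRate_ne_zero {s t : State} (h : N.jumpRate π s t ≠ 0) :
    ∃ i r, t = addUser s i r ∨ s = addUser t i r := by
  by_contra! hcon
  refine h (Finset.sum_eq_zero fun i _ => Finset.sum_eq_zero fun r _ => ?_)
  rw [if_neg (hcon i r).1, if_neg (hcon i r).2, add_zero]

lemma jumpRate_removeUser_pos {s : State} {i r : Fin 2} (h : s i r ≠ 0) :
    0 < N.jumpRate π s (removeUser s i r) := by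
  have h1 : 0 < ENNReal.ofReal (N.departureRate s i r) := ENNReal.ofReal_pos.2 (departureRate_pos h)
  unfold jumpRate
  refine h1.trans_le (le_trans ?_ (Finset.single_le_sum (fun _ _ => zero_le) (Finset.mem_univ i)))
  refine le_trans ?_ (Finset.single_le_sum (fun _ _ => zero_le) (Finset.mem_univ r))
  rw [if_pos (addUser_removeUser h).symm]
  exact le_add_self

/-- Departures have positive rate whatever the policy, so the network can empty one user at a time.
Hence every state reaches every state that is reachable from the empty one. -/
lemma reachable_emptyState (s : State) : MarkovJump.Reachable (N.jumpRate π) s emptyState := by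
  induction hn : ∑ i, ∑ r, s i r generalizing s with
  | zero =>
    have : s = emptyState := by
      funext i r
      simp only [Finset.sum_eq_zero_iff, Finset.mem_univ, true_implies] at hn
      exact hn i r
    exact this ▸ Relation.ReflTransGen.refl
  | succ n ih =>
    obtain ⟨i, r, hir⟩ : ∃ i r, s i r ≠ 0 := by
      by_contra! hcon
      simp [hcon] at hn
    refine Relation.ReflTransGen.head (jumpRate_removeUser_pos hir) (ih _ ?_)
    have := sum_addUser (removeUser s i r) i r
    rw [addUser_removeUser hir] at this
    omega

/-! ### Workloads as Lyapunov functions -/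

variable (N)

/-- The work associated with base station `i`. -/
noncomputable def workload (s : State) (i : Fin 2) : ℝ := ∑ r, (s i r : ℝ) / N.c r

variable {N}

lemma workload_nonneg (s : State) (i : Fin 2) : 0 ≤ N.workload s i :=
  Finset.sum_nonneg fun r _ => div_nonneg (Nat.cast_nonneg _) (c_pos' r).le

lemma workload_addUser (s : State) (i r j : Fin 2) :
    N.workload (addUser s i r) j = N.workload s j + if j = i then (N.c r)⁻¹ else 0 := by
  have h0 : ∀ r', ((addUser s i r j r' : ℕ) : ℝ) / N.c r' =
      (s j r' : ℝ) / N.c r' + if r' = r then (if j = i then (N.c r)⁻¹ else 0) else 0 := by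
    intro r'
    by_cases hj : j = i <;> by_cases hr : r' = r <;> simp [addUser, hj, hr, add_div]
  simp [workload, h0, Finset.sum_add_distrib]

/-- The factor `departureRate` excuses the case `s i r = 0`, where removal changes nothing. A
general `φ` serves the linear and the quadratic functions alike. -/
lemma departureRate_mul_comp_workload_removeUser (s : State) (i r : Fin 2)
    (φ : (Fin 2 → ℝ) → ℝ) :
    N.departureRate s i r * φ (N.workload (removeUser s i r)) =
      N.departureRate s i r * φ fun j => N.workload s j - if j = i then (N.c r)⁻¹ else 0 := by
  by_cases h : s i r = 0
  · simp [departureRate_eq_zero h]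
  · congr 2
    funext j
    have := workload_addUser (N := N) (removeUser s i r) i r j
    rw [addUser_removeUser h] at this
    linarith

lemma workload_eq_zero {s : State} {i : Fin 2} (h : load s i = 0) : N.workload s i = 0 := by
  have h0 : s i 0 = 0 := by unfold load at h; omega
  have h1 : s i 1 = 0 := by unfold load at h; omega
  simp [workload, Fin.sum_univ_two, h0, h1]

/-- A busy base station works at unit speed. -/
lemma sum_departureRate_div (hm : ∀ i, N.m i = 1) (s : State) (i : Fin 2) :
    ∑ r, N.departureRate s i r / N.c r = if load s i = 0 then 0 else N.mu := by
  split_ifs with h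
  · refine Finset.sum_eq_zero fun r _ => ?_
    rw [departureRate_eq_zero, zero_div]
    by_contra hr
    exact (load_pos hr).ne' h
  · have hl : (1 : ℝ) ≤ load s i := by exact_mod_cast Nat.one_le_iff_ne_zero.2 h
    have hl0 : (load s i : ℝ) ≠ 0 := by positivity
    have hc0 := (N.c_pos' 0).ne'
    have hc1 := (N.c_pos' 1).ne'
    have hsum : (load s i : ℝ) = s i 0 + s i 1 := by simp [load]
    simp only [Fin.sum_univ_two, departureRate, throughput, hm, Nat.cast_one, min_eq_left hl]
    field_simp
    rw [hsum]

lemma generator_workload (hm : ∀ i, N.m i = 1) (κ : Fin 2 → ℝ) (s : State) :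
    N.generator π (fun s => ∑ i, κ i * N.workload s i) s =
      ∑ i, κ i * (∑ r, N.arrivalRate π s i r / N.c r - if load s i = 0 then 0 else N.mu) := by
  have h : ∀ i r, N.departureRate s i r * ((∑ j, κ j * N.workload (removeUser s i r) j) -
      ∑ j, κ j * N.workload s j) = N.departureRate s i r * (-(κ i / N.c r)) := by
    intro i r
    rw [departureRate_mul_comp_workload_removeUser s i r
      fun W => (∑ j, κ j * W j) - ∑ j, κ j * N.workload s j]
    congr 1
    simp [mul_sub, Finset.sum_sub_distrib, div_eq_mul_inv]
  simp only [generator, h, workload_addUser, mul_add, Finset.sum_add_distrib, add_sub_cancel_left,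
    mul_ite, mul_zero, Finset.sum_ite_eq', Finset.mem_univ, if_true]
  rw [← Finset.sum_add_distrib]
  refine Finset.sum_congr rfl fun i _ => ?_
  rw [← sum_departureRate_div hm]
  simp only [Fin.sum_univ_two]
  ring

lemma generator_sq_workload (hm : ∀ i, N.m i = 1) (s : State) :
    N.generator π (fun s => ∑ i, N.workload s i ^ 2) s =
      ∑ i, (2 * N.workload s i * (∑ r, N.arrivalRate π s i r / N.c r - N.mu) +
        ∑ r, (N.arrivalRate π s i r + N.departureRate s i r) * ((N.c r)⁻¹) ^ 2) := by
  have h : ∀ i r, N.departureRate s i r * ((∑ j, N.workload (removeUser s i r) j ^ 2) -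
      ∑ j, N.workload s j ^ 2) = N.departureRate s i r *
        (-(2 * N.workload s i * (N.c r)⁻¹) + ((N.c r)⁻¹) ^ 2) := by
    intro i r
    rw [departureRate_mul_comp_workload_removeUser s i r
      fun W => (∑ j, W j ^ 2) - ∑ j, N.workload s j ^ 2]
    congr 1
    fin_cases i <;> simp [Fin.sum_univ_two] <;> ring
  have h' : ∀ i r, (∑ j, N.workload (addUser s i r) j ^ 2) - ∑ j, N.workload s j ^ 2 =
      2 * N.workload s i * (N.c r)⁻¹ + ((N.c r)⁻¹) ^ 2 := by
    intro i r
    simp only [workload_addUser]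
    fin_cases i <;> simp [Fin.sum_univ_two] <;> ring
  -- An idle station has zero workload, so the idle case disappears from the quadratic drift.
  have hW : ∀ i, N.workload s i * ∑ r, N.departureRate s i r / N.c r = N.workload s i * N.mu := by
    intro i
    rw [sum_departureRate_div hm]
    split_ifs with hl
    · simp [workload_eq_zero hl]
    · rfl
  simp only [generator, h, h']
  refine Finset.sum_congr rfl fun i _ => ?_
  have := hW i
  simp only [Fin.sum_univ_two] at this ⊢
  linear_combination (-2) * this

lemma c_le_c_one (r : Fin 2) : N.c r ≤ N.c 1 := by
  have := N.c_lt
  fin_cases r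
  · exact this.le
  · exact le_rfl

lemma inv_c_le_one (hc : N.c 0 = 1) (r : Fin 2) : (N.c r)⁻¹ ≤ 1 := by
  refine inv_le_one_of_one_le₀ ?_
  have := N.c_lt
  fin_cases r
  · exact hc.ge
  · exact hc ▸ this.le

/-- Since `c r ≤ c 1`, users leave a station at most `c 1` times as fast as work does. -/
lemma totalRate_le (hm : ∀ i, N.m i = 1) (s : State) :
    N.totalRate π s ≤ N.lam + 2 * (N.mu * N.c 1) := by
  have h : ∀ i, ∑ r, N.departureRate s i r ≤ N.mu * N.c 1 := by
    intro i
    calc ∑ r, N.departureRate s i r ≤ ∑ r, N.departureRate s i r / N.c r * N.c 1 := by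
          refine Finset.sum_le_sum fun r _ => ?_
          rw [div_mul_eq_mul_div, le_div_iff₀ (c_pos' r)]
          exact mul_le_mul_of_nonneg_left (c_le_c_one r) (departureRate_nonneg s i r)
      _ ≤ N.mu * N.c 1 := by
          rw [← Finset.sum_mul, sum_departureRate_div hm]
          refine mul_le_mul_of_nonneg_right ?_ (c_pos' 1).le
          split_ifs
          · exact N.mu_pos.le
          · exact le_rfl
  simp only [totalRate, Finset.sum_add_distrib]
  rw [sum_arrivalRate, Fin.sum_univ_two]
  linarith [h 0, h 1]

lemma finite_setOf_workload_lt (K : ℝ) : {s : State | ∑ i, N.workload s i < K}.Finite := by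
  refine (Set.finite_Icc (0 : State) fun _ _ => ⌈K * N.c 1⌉₊).subset fun s hs => ?_
  refine ⟨fun _ _ => Nat.zero_le _, fun i r => ?_⟩
  have h1 : (s i r : ℝ) / N.c 1 ≤ N.workload s i :=
    (div_le_div_of_nonneg_left (Nat.cast_nonneg _) (c_pos' r) (c_le_c_one r)).trans
      (Finset.single_le_sum (f := fun r => (s i r : ℝ) / N.c r)
        (fun r _ => div_nonneg (Nat.cast_nonneg _) (c_pos' r).le) (Finset.mem_univ r))
  have h2 : N.workload s i ≤ ∑ i, N.workload s i :=
    Finset.single_le_sum (fun i _ => workload_nonneg s i) (Finset.mem_univ i)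
  have h3 : (s i r : ℝ) ≤ K * N.c 1 := by
    rw [← div_le_iff₀ (c_pos' 1)]
    exact (h1.trans h2).trans (le_of_lt hs)
  exact_mod_cast h3.trans (Nat.le_ceil _)

/-- The system is stable if each base station receives work at a rate that is less than its
speed. -/
theorem stableUnder_of_load_lt (hm : ∀ i, N.m i = 1) (hc : N.c 0 = 1) {ε : ℝ} (hε : 0 < ε)
    (hload : ∀ s i, ∑ r, N.arrivalRate π s i r / N.c r ≤ N.mu - ε) : N.StableUnder π := by
  set v : State → ℝ := fun s => ∑ i, N.workload s i ^ 2 with hv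
  have hv0 : ∀ s, 0 ≤ v s := fun s => Finset.sum_nonneg fun i _ => sq_nonneg _
  -- The second-order terms are at most the total rate, because `1 / c r ≤ 1`.
  have hgen : ∀ s, N.generator π v s ≤
      -(2 * ε * ∑ i, N.workload s i) + N.totalRate π s := by
    intro s
    rw [hv, generator_sq_workload hm, totalRate, Finset.mul_sum, ← Finset.sum_neg_distrib,
      ← Finset.sum_add_distrib]
    refine Finset.sum_le_sum fun i _ => add_le_add ?_ (Finset.sum_le_sum fun r _ => ?_)
    · have := mul_le_mul_of_nonneg_left (hload s i) (workload_nonneg (N := N) s i)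
      linarith
    · refine mul_le_of_le_one_right
        (add_nonneg (arrivalRate_nonneg s i r) (departureRate_nonneg s i r)) ?_
      exact pow_le_one₀ (inv_nonneg.2 (c_pos' r).le) (inv_c_le_one hc r)
  intro s _
  refine Or.inr (MarkovJump.meanReturnTime_lt_top _ s (lo := ENNReal.ofReal N.lam)
    (ENNReal.ofReal_pos.2 N.lam_pos).ne'
    (fun x => by rw [exitRate_jumpRate]; exact ENNReal.ofReal_le_ofReal (lam_le_totalRate x)) ?_)
  rename_i hs
  refine MarkovJump.meanReturnSteps_lt_top_of_foster exitRate_jumpRate_ne_zero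
    exitRate_jumpRate_ne_top (fun x => (reachable_emptyState x).trans hs)
    (fun s => ENNReal.ofReal (v s)) (fun _ => ENNReal.ofReal_ne_top)
    -- Beyond this level `ε * ∑ workload` exceeds the bound on the total rate, so the generator is
    -- at most minus the total rate: drift `-1` per jump.
    (finite_setOf_workload_lt (N := N) ((N.lam + 2 * (N.mu * N.c 1)) / ε))
    (fun x hx => ?_) ENNReal.one_ne_top (fun x => ?_)
  · have hpos := totalRate_pos (N := N) (π := π) x
    rw [lintegral_jumpKernel_ofReal x hv0, ← ENNReal.ofReal_one,
      ← ENNReal.ofReal_add (add_generator_div_nonneg x hv0) zero_le_one]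
    refine ENNReal.ofReal_le_ofReal ?_
    have hx' : N.totalRate π x ≤ ε * ∑ i, N.workload x i := by
      rw [Set.mem_ofPred_eq, not_lt, div_le_iff₀ hε] at hx
      rw [mul_comm ε]
      exact (totalRate_le hm x).trans hx
    have : N.generator π v x / N.totalRate π x ≤ -1 := by
      rw [div_le_iff₀ hpos]
      linarith [hgen x]
    linarith
  · have hpos := totalRate_pos (N := N) (π := π) x
    rw [lintegral_jumpKernel_ofReal x hv0, ← ENNReal.ofReal_one,
      ← ENNReal.ofReal_add (hv0 x) zero_le_one]
    refine ENNReal.ofReal_le_ofReal (add_le_add_right ?_ _)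
    rw [div_le_iff₀ hpos]
    have : 0 ≤ 2 * ε * ∑ i, N.workload x i :=
      mul_nonneg (by positivity) (Finset.sum_nonneg fun i _ => workload_nonneg x i)
    linarith [hgen x]

/-- The system is unstable if a weighted sum of the rates at which the base stations receive work
is at least the weighted sum of their speeds. -/
theorem not_stableUnder_of_le_load (hm : ∀ i, N.m i = 1) {κ : Fin 2 → ℝ} (hκ : ∀ i, 0 < κ i)
    (hload : ∀ s, ∑ i, κ i * N.mu ≤ ∑ i, κ i * ∑ r, N.arrivalRate π s i r / N.c r) :
    ¬ N.StableUnder π := by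
  intro hstable
  set v : State → ℝ := fun s => ∑ i, κ i * N.workload s i with hv
  have hv0 : ∀ s, 0 ≤ v s := fun s =>
    Finset.sum_nonneg fun i _ => mul_nonneg (hκ i).le (workload_nonneg s i)
  have hve : v emptyState = 0 := by simp [hv, workload, emptyState]
  -- Idle stations only increase the drift.
  have hgen : ∀ s, 0 ≤ N.generator π v s := by
    intro s
    rw [hv, generator_workload hm]
    simp only [mul_sub, Finset.sum_sub_distrib, sub_nonneg]
    refine le_trans (Finset.sum_le_sum fun i _ => mul_le_mul_of_nonneg_left ?_ (hκ i).le) (hload s)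
    split_ifs
    · exact N.mu_pos.le
    · exact le_rfl
  -- Nothing is served in the empty state, so the drift there is strictly positive.
  have hgene : 0 < N.generator π v emptyState := by
    rw [hv, generator_workload hm]
    simp only [load, emptyState, add_zero, if_true, sub_zero]
    refine lt_of_lt_of_le ?_ (hload _)
    exact Finset.sum_pos (fun i _ => mul_pos (hκ i) N.mu_pos) Finset.univ_nonempty
  have hadd : ∀ s i r, v (addUser s i r) = v s + κ i / N.c r := by
    intro s i r
    simp only [hv, workload_addUser, mul_add, Finset.sum_add_distrib, div_eq_mul_inv, mul_ite,
      mul_zero, Finset.sum_ite_eq', Finset.mem_univ, if_true]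
  have hstep : ∀ i r, κ i / N.c r ≤ ∑ i, ∑ r, κ i / N.c r := fun i r =>
    (Finset.single_le_sum (f := fun r => κ i / N.c r)
      (fun r _ => div_nonneg (hκ i).le (c_pos' r).le) (Finset.mem_univ r)).trans
    (Finset.single_le_sum (f := fun i => ∑ r, κ i / N.c r)
      (fun i _ => Finset.sum_nonneg fun r _ => div_nonneg (hκ i).le (c_pos' r).le)
      (Finset.mem_univ i))
  have htop := MarkovJump.meanReturnSteps_eq_top_of_drift (q := N.jumpRate π)
    exitRate_jumpRate_ne_zero exitRate_jumpRate_ne_top (s := emptyState)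
    (fun s => ENNReal.ofReal (v s)) (by simp [hve])
    (fun x => by
      rw [lintegral_jumpKernel_ofReal x hv0]
      exact ENNReal.ofReal_le_ofReal
        (le_add_of_nonneg_right (div_nonneg (hgen x) (totalRate_pos x).le)))
    (by
      rw [lintegral_jumpKernel_ofReal _ hv0, hve, zero_add]
      exact (ENNReal.ofReal_pos.2 (div_pos hgene (totalRate_pos _))).ne')
    (B := ENNReal.ofReal (∑ i, ∑ r, κ i / N.c r)) ENNReal.ofReal_ne_top
    (fun x y hxy => by
      have hB : 0 ≤ ∑ i, ∑ r, κ i / N.c r := Finset.sum_nonneg fun i _ =>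
        Finset.sum_nonneg fun r _ => div_nonneg (hκ i).le (c_pos' r).le
      rw [← ENNReal.ofReal_add (hv0 x) hB]
      refine ENNReal.ofReal_le_ofReal ?_
      obtain ⟨i, r, rfl | rfl⟩ := eq_addUser_of_jumpRate_ne_zero hxy
      · rw [hadd]
        exact add_le_add_right (hstep i r) _
      · rw [hadd]
        have := div_pos (hκ i) (N.c_pos' r)
        linarith)
  rcases hstable emptyState Relation.ReflTransGen.refl with h | h
  · exact exitRate_jumpRate_ne_zero _ h
  · refine (MarkovJump.meanReturnSteps_lt_top _ _
      (hi := ENNReal.ofReal (N.lam + 2 * (N.mu * N.c 1))) ENNReal.ofReal_ne_top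
      (fun x => ?_) h).ne htop
    rw [exitRate_jumpRate]
    exact ENNReal.ofReal_le_ofReal (totalRate_le hm x)

/-! ### The stability region -/

lemma exists_pmf_fin_two {a b : Fin 2} (hab : a ≠ b) {x : ℝ} (h0 : 0 ≤ x) (h1 : x ≤ 1) :
    ∃ P : PMF (Fin 2), (P a).toReal = x ∧ (P b).toReal = 1 - x := by
  refine ⟨PMF.ofFintype (fun i => if i = a then ENNReal.ofReal x else ENNReal.ofReal (1 - x)) ?_,
    ?_, ?_⟩
  · rw [sum_fin_two_of_ne hab, if_pos rfl, if_neg hab.symm, ← ENNReal.ofReal_add h0 (by linarith)]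
    simp
  · simp [h0]
  · simp [hab.symm, h1]

/-- The stability region, when `a` is the hotspot with the larger arrival rate. -/
theorem exists_stableUnder_iff (hm : ∀ i, N.m i = 1) (hc : N.c 0 = 1) {a b : Fin 2} (hab : a ≠ b)
    (hp : N.p b ≤ N.p a) :
    (∃ π : Policy, N.StableUnder π) ↔
      N.lam < N.mu * N.c 1 * (1 + N.c 1) / (N.p a * N.c 1 + N.p b) := by
  have hsum : N.p a + N.p b = 1 := by
    rw [← sum_fin_two_of_ne hab, Fin.sum_univ_two, N.p_sum]
  have hpb := N.p_nonneg b
  have hpa : 0 < N.p a := by linarith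
  have hc1 : 1 < N.c 1 := hc ▸ N.c_lt
  have hc1' : 0 < N.c 1 := by linarith
  have hlam := N.lam_pos
  have hmu := N.mu_pos
  have hden : 0 < N.p a * N.c 1 + N.p b := by positivity
  have hden2 : 0 < N.c 1 * (1 + N.c 1) := by positivity
  rw [lt_div_iff₀ hden]
  constructor
  · rintro ⟨π, hπ⟩
    by_contra! hcon
    -- These weights make both choices of a user of `a` equally costly, so the policy matters only
    -- for users of `b`.
    refine not_stableUnder_of_le_load (π := π) hm (κ := fun i => if i = a then N.c 1 else 1)
      (fun i => by split_ifs <;> linarith) (fun s => ?_) hπ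
    rw [sum_fin_two_of_ne hab, sum_fin_two_of_ne hab, if_pos rfl, if_neg hab.symm]
    simp only [Fin.sum_univ_two, arrivalRate]
    rw [joinProb_one s hab, joinProb_one s hab.symm, joinProb_zero s hab, joinProb_zero s hab.symm,
      hc]
    have ha := sum_toReal_pmf (π s a) hab
    have hb := sum_toReal_pmf (π s b) hab
    have hba : 0 ≤ (π s b a).toReal := ENNReal.toReal_nonneg
    -- Least weighted input plus the excess from users of `b` sent to `a`, each bringing `c 1`
    -- instead of `1 / c 1`.
    have hw : N.lam * (N.p a + N.p b / N.c 1) + N.lam * N.p b * (π s b a).toReal *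
        (N.c 1 - 1 / N.c 1) = N.c 1 * (N.lam * (N.p b * (π s b a).toReal) / 1 +
          N.lam * (N.p a * (π s a a).toReal) / N.c 1) +
        1 * (N.lam * (N.p a * (π s a b).toReal) / 1 +
          N.lam * (N.p b * (π s b b).toReal) / N.c 1) := by
      rw [← eq_sub_iff_add_eq'] at ha hb
      rw [ha, hb]
      field_simp
      ring
    rw [← hw]
    have h1 : 0 ≤ N.c 1 - 1 / N.c 1 := by
      rw [sub_nonneg, div_le_iff₀ hc1']
      nlinarith
    have h2 : N.mu * (1 + N.c 1) ≤ N.lam * (N.p a + N.p b / N.c 1) := by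
      rw [show N.lam * (N.p a + N.p b / N.c 1) = N.lam * (N.p a * N.c 1 + N.p b) / N.c 1 by
        field_simp, le_div_iff₀ hc1']
      linarith
    have h3 := mul_nonneg (mul_nonneg (mul_nonneg hlam.le hpb) hba) h1
    linarith
  · intro h
    -- Solves `p a * α / c 1 = p b / c 1 + p a * (1 - α)`; `α ≤ 1` is where `p b ≤ p a` enters.
    set α := (N.p a * N.c 1 + N.p b) / ((1 + N.c 1) * N.p a) with hα
    have hα0 : 0 ≤ α := by positivity
    have hα1 : α ≤ 1 := by
      rw [hα, div_le_one (by positivity)]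
      linarith
    obtain ⟨P, hPa, hPb⟩ := exists_pmf_fin_two hab hα0 hα1
    obtain ⟨Q, hQa, hQb⟩ := exists_pmf_fin_two hab le_rfl zero_le_one
    refine ⟨fun _ k => if k = a then P else Q, stableUnder_of_load_lt hm hc
      -- The margin between `μ` and the common work input of the two stations.
      (ε := N.mu - N.lam * (N.p a * N.c 1 + N.p b) / (N.c 1 * (1 + N.c 1))) ?_ fun s i => ?_⟩
    · rw [sub_pos, div_lt_iff₀ hden2]
      linarith
    · rw [sub_sub_cancel]
      simp only [Fin.sum_univ_two, arrivalRate]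
      have hi : i = a ∨ i = b := by
        fin_cases i <;> fin_cases a <;> fin_cases b <;> simp_all
      apply le_of_eq
      rcases hi with rfl | rfl
      · rw [joinProb_one s hab, joinProb_zero s hab, if_pos rfl, if_neg hab.symm, hPa, hQa, hα]
        field_simp
        ring
      · rw [joinProb_one s hab.symm, joinProb_zero s hab.symm, if_pos rfl, if_neg hab.symm, hPb,
          hQb, hα, hc]
        field_simp
        ring

end TwoBSNetwork

theorem mainTheorem6 (N : TwoBSNetwork) (hm : ∀ i, N.m i = 1) (hc : N.c 0 = 1) :
    (∃ π : TwoBSNetwork.Policy, N.StableUnder π) ↔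
      N.lam < N.mu * N.c 1 * (1 + N.c 1) /
        (max (N.p 0) (N.p 1) * N.c 1 + min (N.p 0) (N.p 1)) := by
  rcases le_total (N.p 0) (N.p 1) with h | h
  · rw [max_eq_right h, min_eq_left h]
    exact TwoBSNetwork.exists_stableUnder_iff hm hc (by decide) h
  · rw [max_eq_left h, min_eq_right h]
    exact TwoBSNetwork.exists_stableUnder_iff hm hc (by decide) h
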